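/- Let $r\ge 1$ and $n\ge 0$ be integers. An \emph{ordered $r$-matching} is an $r$-uniform hypergraph on a finite totally ordered vertex set in which every edge has exactly $r$ vertices and every vertex lies in exactly one edge; its \emph{size} is its number of edges. An \emph{$r$-pattern} is an ordered $r$-matching of size $2$ (on the vertex set $\{1,\dots,2r\}$). For an $r$-pattern $P$, a set of edges of an ordered $r$-matching is a \emph{$P$-clique} if any two distinct edges in it form, with the induced order on their vertices, a matching order-isomorphic to $P$. For an ordered $r$-matching $M$ let $L(M)$ be the largest size of a set of edges of $M$ that is a $P$-clique for some $r$-pattern $P$, and let $L_r(n)$ be the minimum of $L(M)$ over all ordered $r$-matchings $M$ of size $n$. Theorem. For every integer $n\ge 0$, \[ \tfrac12\, n^{1/7}\le L_3(n)\le \lceil n^{1/7}\rceil \qquad\text{and}\qquad \tfrac14\, n^{1/15}\le L_4(n)\le \lceil n^{1/15}\rceil . \] -/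

import Mathlib

/-- An ordered `r`-matching on a linearly ordered vertex set `V`: a family of `r`-element edges
such that every vertex lies in exactly one edge. -/
structure OrderedMatching (r : ℕ) (V : Type*) [LinearOrder V] where
  edges : Finset (Finset V)
  card_of_mem_edges : ∀ e ∈ edges, e.card = r
  existsUnique_edge : ∀ v : V, ∃! e : Finset V, e ∈ edges ∧ v ∈ e

namespace OrderedMatching

variable {r : ℕ} {V : Type*} [LinearOrder V]

/-- The size of a matching is its number of edges. -/
def size (M : OrderedMatching r V) : ℕ := M.edges.card

end OrderedMatching

/-- An `r`-pattern: an `r`-matching of size two on `2 r` ordered vertices. -/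
def MatchingPattern (r : ℕ) : Type :=
  {P : OrderedMatching r (Fin (2 * r)) // P.size = 2}

namespace MatchingPattern

variable {r : ℕ} {V : Type*} [LinearOrder V]

/-- The pair of edges `e, f` is order-isomorphic to `P`: some strictly increasing map from the
vertices of `P` to `V` carries the edge set of `P` onto `{e, f}`. As every vertex of `P` lies in an
edge, the range of such a map is exactly `e ∪ f`. -/
def Forms (P : MatchingPattern r) (e f : Finset V) : Prop :=
  ∃ φ : Fin (2 * r) ↪o V, P.1.edges.image (fun a => a.map φ.toEmbedding) = {e, f}

/-- A set of edges is a `P`-clique if every pair of distinct edges in it forms the pattern `P`. -/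
def IsClique (P : MatchingPattern r) (S : Finset (Finset V)) : Prop :=
  ∀ e ∈ S, ∀ f ∈ S, e ≠ f → P.Forms e f

end MatchingPattern

namespace OrderedMatching

variable {r : ℕ} {V : Type*} [LinearOrder V]

open Classical in
/-- `L_P(M)`: the largest size of a `P`-clique contained in `M`. -/
noncomputable def cliqueNumber (M : OrderedMatching r V) (P : MatchingPattern r) : ℕ :=
  (M.edges.powerset.filter (fun S => P.IsClique S)).sup Finset.card

/-- `L(M) = max_P L_P(M)`, the maximum over all `r`-patterns `P`. The supremum is over a family
bounded by the size of `M`, see `cliqueNumber_le_size`. -/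
noncomputable def maxClique (M : OrderedMatching r V) : ℕ :=
  ⨆ P : MatchingPattern r, M.cliqueNumber P

theorem cliqueNumber_le_size (M : OrderedMatching r V) (P : MatchingPattern r) :
    M.cliqueNumber P ≤ M.size := by
  classical
  refine Finset.sup_le fun S hS => ?_
  exact Finset.card_le_card (Finset.mem_powerset.1 (Finset.mem_filter.1 hS).1)

theorem cliqueNumber_le_maxClique (M : OrderedMatching r V) (P : MatchingPattern r) :
    M.cliqueNumber P ≤ M.maxClique :=
  le_ciSup (f := fun P => M.cliqueNumber P)
    ⟨M.size, by rintro _ ⟨Q, rfl⟩; exact M.cliqueNumber_le_size Q⟩ P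

/-- The vertices of `Fin (r * n)` congruent to `j` modulo `n`. -/
def residueEdge (r : ℕ) {n : ℕ} (j : Fin n) : Finset (Fin (r * n)) :=
  Finset.univ.filter (fun v => (finProdFinEquiv.symm v).2 = j)

theorem mem_residueEdge {r n : ℕ} {j : Fin n} {v : Fin (r * n)} :
    v ∈ residueEdge r j ↔ (finProdFinEquiv.symm v).2 = j := by
  simp only [residueEdge, Finset.mem_filter, Finset.mem_univ, true_and]

theorem card_residueEdge (r : ℕ) {n : ℕ} (j : Fin n) : (residueEdge r j).card = r := by
  have h : Function.Injective (fun i : Fin r => finProdFinEquiv (i, j)) := fun a b hab =>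
    congrArg Prod.fst (finProdFinEquiv.injective hab)
  have h2 : residueEdge r j = Finset.univ.image (fun i : Fin r => finProdFinEquiv (i, j)) := by
    ext v
    rw [mem_residueEdge, Finset.mem_image]
    constructor
    · intro hv
      exact ⟨(finProdFinEquiv.symm v).1, Finset.mem_univ _, by
        rw [← hv, Prod.mk.eta, Equiv.apply_symm_apply]⟩
    · rintro ⟨i, -, rfl⟩
      rw [Equiv.symm_apply_apply]
  rw [h2, Finset.card_image_of_injective _ h, Finset.card_univ, Fintype.card_fin]

/-- The matching on `r n` ordered vertices whose edges are the residue classes modulo `n`. It shows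
that matchings of every size exist, so that the minimum in `ramseyNumber` is over a nonempty set. -/
def residueMatching (r n : ℕ) : OrderedMatching r (Fin (r * n)) where
  edges := Finset.univ.image (fun j : Fin n => residueEdge r j)
  card_of_mem_edges := by
    intro e he
    obtain ⟨j, -, rfl⟩ := Finset.mem_image.1 he
    exact card_residueEdge r j
  existsUnique_edge := by
    intro v
    refine ⟨residueEdge r (finProdFinEquiv.symm v).2,
      ⟨Finset.mem_image_of_mem _ (Finset.mem_univ _), mem_residueEdge.2 rfl⟩, ?_⟩
    rintro e ⟨he, hv⟩
    obtain ⟨k, -, rfl⟩ := Finset.mem_image.1 he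
    rw [mem_residueEdge.1 hv]

theorem size_residueMatching {r : ℕ} (hr : 0 < r) (n : ℕ) : (residueMatching r n).size = n := by
  have h : Function.Injective (fun j : Fin n => residueEdge r j) := by
    intro j k hjk
    have hpos : 0 < (residueEdge r j).card := by rw [card_residueEdge]; exact hr
    obtain ⟨v, hv⟩ := Finset.card_pos.1 hpos
    have hv' : v ∈ residueEdge r k := by
      have hjk' : residueEdge r j = residueEdge r k := hjk
      rwa [← hjk']
    rw [← mem_residueEdge.1 hv, ← mem_residueEdge.1 hv']
  unfold size residueMatching
  rw [Finset.card_image_of_injective _ h, Finset.card_univ, Fintype.card_fin]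

end OrderedMatching

/-- `L_r(n)`: the minimum of `L(M)` over all ordered `r`-matchings `M` of size `n`. (Up to order
isomorphism such a matching has `r n` vertices numbered in increasing order.) -/
noncomputable def ramseyNumber (r n : ℕ) : ℕ :=
  sInf {k : ℕ | ∃ M : OrderedMatching r (Fin (r * n)), M.size = n ∧ M.maxClique = k}

/-- For `r ≥ 1` the minimum defining `L_r(n)` is attained. -/
theorem isLeast_ramseyNumber {r : ℕ} (hr : 0 < r) (n : ℕ) :
    IsLeast {k : ℕ | ∃ M : OrderedMatching r (Fin (r * n)), M.size = n ∧ M.maxClique = k}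
      (ramseyNumber r n) := by
  have h : {k : ℕ | ∃ M : OrderedMatching r (Fin (r * n)),
      M.size = n ∧ M.maxClique = k}.Nonempty :=
    ⟨_, OrderedMatching.residueMatching r n, OrderedMatching.size_residueMatching hr n, rfl⟩
  exact ⟨Nat.sInf_mem h, fun _ hk => Nat.sInf_le hk⟩

/-!
For every `r ≥ 1` the two bounds `n ≤ (2 r - 1)‼ * L_r(n) ^ (2 ^ r - 1)` and
`L_r(n) ≤ m` whenever `n ≤ m ^ (2 ^ r - 1)` hold; the constants `1 / 2` and `1 / 4` come from
`5‼ ≤ 2 ^ 7` and `7‼ ≤ 4 ^ 15`.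

*Lower bound.* Number the vertices of each edge increasingly. A family of edges has a cut at `d` if
some threshold separates, in all of its edges at once, the positions up to `d` from the later ones.
In a family with a set `D` of cuts the positions fall into blocks. For each choice of signs of the
blocks, up to a global sign, let `e` precede `f` if `e` is entirely before `f` in the positive
blocks and entirely after it in the negative ones. This is a partial order, and its chains are
cliques (`sameOrder_of_precedes`). As there are `2 ^ #D` such orders, Mirsky's theorem
(`exists_antichain_of_chain_card_le`) yields a subfamily, smaller by a factor at most `m ^ (2 ^ #D)`, with
`m` the maximal clique size, that is an antichain for all of them. Any two of its edges have
intersecting blocks, so the first vertex of a block of one lies between two consecutive vertices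
of that block of the other (`exists_crosses_of_not_precedes`). Charging the pair to this vertex and
gap, the pigeonhole principle gives a constant proportion of edges with a new common cut. After
`r - 1` new cuts the blocks are single vertices, which never intersect. The exponents add up to
`1 + 2 + ⋯ + 2 ^ (r - 1) = 2 ^ r - 1` (`card_le_of_hasCuts`).

*Upper bound.* Run this backwards. The edges are vectors in `Fin m ^ (2 ^ r - 1)`, with one
coordinate for each `k < r` and each choice of signs, up to a global sign, of the blocks
`{0}, …, {k - 1}, {k, …, r - 1}`; coordinates with fewer cuts come first. The vertices are placed
so that the pattern of two edges is given by the cuts and signs of the first coordinate in which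
they differ (`key_compare`). Hence all pairs in a clique first differ in the same coordinate
(`first_difference_eq`), and a clique has at most `m` edges.
-/

namespace OrderedMatching

open Finset Function

variable {r : ℕ} {ι V W : Type*} [LinearOrder V] [LinearOrder W]

/-! ### Patterns and interlacings of two edges -/

theorem exists_equiv_fin_lt_iff {α : Type*} [Fintype α] {k : ℕ} (hk : Fintype.card α = k)
    {x : α → V} (hx : Injective x) : ∃ ρ : α ≃ Fin k, ∀ a b, ρ a < ρ b ↔ x a < x b := by
  let := LinearOrder.lift' x hx
  exact ⟨(Fintype.orderIsoFinOfCardEq α hk).symm.toEquiv,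
    fun a b => (Fintype.orderIsoFinOfCardEq α hk).symm.lt_iff_lt⟩

/-- The matching on `V` whose edges are the fibres over `ι` of a labelling of the vertices by
`ι × Fin r`. -/
def ofEquiv [Fintype ι] (ρ : ι × Fin r ≃ V) : OrderedMatching r V where
  edges := univ.image fun a => univ.image fun i => ρ (a, i)
  card_of_mem_edges := by
    intro e he
    obtain ⟨a, -, rfl⟩ := mem_image.1 he
    rw [card_image_of_injective, card_univ, Fintype.card_fin]
    intro i j hij
    exact congrArg Prod.snd (ρ.injective hij)
  existsUnique_edge := by
    intro v
    refine ⟨univ.image fun i => ρ ((ρ.symm v).1, i), ⟨mem_image_of_mem _ (mem_univ _),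
      mem_image.2 ⟨(ρ.symm v).2, mem_univ _, by simp⟩⟩, ?_⟩
    rintro e ⟨he, hv⟩
    obtain ⟨a, -, rfl⟩ := mem_image.1 he
    obtain ⟨i, -, rfl⟩ := mem_image.1 hv
    simp

theorem injective_edge_ofEquiv (hr : 0 < r) (ρ : ι × Fin r ≃ V) :
    Injective fun a => univ.image fun i => ρ (a, i) := by
  intro a b hab
  have h : ρ (a, ⟨0, hr⟩) ∈ univ.image fun i => ρ (b, i) :=
    (Finset.ext_iff.1 hab _).1 (mem_image_of_mem (fun i => ρ (a, i)) (mem_univ _))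
  obtain ⟨i, -, hi⟩ := mem_image.1 h
  exact (congrArg Prod.fst (ρ.injective hi)).symm

theorem size_ofEquiv [Fintype ι] (hr : 0 < r) (ρ : ι × Fin r ≃ V) :
    (ofEquiv ρ).size = Fintype.card ι := by
  unfold size ofEquiv
  rw [card_image_of_injective _ (injective_edge_ofEquiv hr ρ), card_univ]

/-- The `r`-pattern in which the labelling `ρ` interlaces the two edges. -/
def patternOfEquiv (hr : 0 < r) (ρ : Bool × Fin r ≃ Fin (2 * r)) : MatchingPattern r :=
  ⟨ofEquiv ρ, size_ofEquiv hr ρ⟩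

theorem forms_patternOfEquiv (hr : 0 < r) {ρ : Bool × Fin r ≃ Fin (2 * r)}
    {x : Bool → Fin r → V} (h : ∀ a b, ρ a < ρ b ↔ x a.1 a.2 < x b.1 b.2) :
    (patternOfEquiv hr ρ).Forms (univ.image (x true)) (univ.image (x false)) := by
  have hmono : StrictMono fun v => x (ρ.symm v).1 (ρ.symm v).2 := by
    intro v w hvw
    rw [← h]
    simpa using hvw
  obtain ⟨φ, hφ⟩ : ∃ φ : Fin (2 * r) ↪o V, ∀ v, φ v = x (ρ.symm v).1 (ρ.symm v).2 :=
    ⟨OrderEmbedding.ofStrictMono _ hmono, fun _ => rfl⟩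
  have key : ∀ a, (univ.image fun i => ρ (a, i)).map φ.toEmbedding = univ.image (x a) := by
    intro a
    ext w
    simp [hφ]
  refine ⟨φ, ?_⟩
  simp only [patternOfEquiv, ofEquiv, image_image, Function.comp_def, key]
  ext s
  simp

/-- Two pairs of edges, each edge enumerated increasingly, are interlaced in the same way. -/
def SameOrder (u v u' v' : Fin r → V) : Prop :=
  ∀ i j, (u i < v j ↔ u' i < v' j) ∧ (v i < u j ↔ v' i < u' j)

/-- The pattern formed by two edges depends only on their interlacing. -/
theorem exists_forall_forms (hr : 0 < r) {u v : Fin r → V} (hu : StrictMono u) (hv : StrictMono v)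
    (huv : ∀ i j, u i ≠ v j) :
    ∃ P : MatchingPattern r, ∀ u' v' : Fin r → V, StrictMono u' → StrictMono v' →
      SameOrder u v u' v' → P.Forms (univ.image u') (univ.image v') := by
  have hinj : Injective fun a : Bool × Fin r => (bif a.1 then u else v) a.2 := by
    rintro ⟨_ | _, i⟩ ⟨_ | _, j⟩ hij
    · simpa using hv.injective hij
    · exact absurd hij.symm (huv _ _)
    · exact absurd hij (huv _ _)
    · simpa using hu.injective hij
  obtain ⟨ρ, hρ⟩ := exists_equiv_fin_lt_iff (k := 2 * r) (by simp) hinj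
  refine ⟨patternOfEquiv hr ρ, fun u' v' hu' hv' h => ?_⟩
  refine forms_patternOfEquiv (x := fun b => bif b then u' else v') hr ?_
  rintro ⟨_ | _, i⟩ ⟨_ | _, j⟩ <;> rw [hρ] <;> simp only [cond_true, cond_false]
  · rw [hv.lt_iff_lt, hv'.lt_iff_lt]
  · exact (h i j).2
  · exact (h i j).1
  · rw [hu.lt_iff_lt, hu'.lt_iff_lt]

theorem eq_comp_of_map_eq {s : Finset W} (hs : s.card = r) {φ : W ↪o V} {u : Fin r → V}
    (hu : StrictMono u) (h : s.map φ.toEmbedding = univ.image u) (i : Fin r) :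
    u i = φ (s.orderEmbOfFin hs i) := by
  have hc : (univ.image u).card = r := by
    rw [card_image_of_injective _ hu.injective, card_univ, Fintype.card_fin]
  have h1 := orderEmbOfFin_unique hc (fun i => mem_image_of_mem u (mem_univ i)) hu
  have h2 := orderEmbOfFin_unique hc (f := fun i => φ (s.orderEmbOfFin hs i)) (fun i => by
    rw [← h]
    exact mem_map_of_mem _ (orderEmbOfFin_mem s hs i))
    (fun i j hij => φ.strictMono ((s.orderEmbOfFin hs).strictMono hij))
  rw [congrFun h1 i, ← congrFun h2 i]

/-- Two pairs of edges that form the same pattern are interlaced in the same way, after possibly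
exchanging the edges of one pair. -/
theorem sameOrder_or_swap_of_forms {P : MatchingPattern r} {u v u' v' : Fin r → V}
    (hu : StrictMono u) (hv : StrictMono v) (hu' : StrictMono u') (hv' : StrictMono v')
    (h : P.Forms (univ.image u) (univ.image v)) (h' : P.Forms (univ.image u') (univ.image v')) :
    SameOrder u v u' v' ∨ SameOrder u v v' u' := by
  obtain ⟨A, B, -, hAB⟩ := card_eq_two.1 P.2
  have hA : A.card = r := P.1.card_of_mem_edges A (by simp [hAB])
  have hB : B.card = r := P.1.card_of_mem_edges B (by simp [hAB])
  have key : ∀ w z : Fin r → V, StrictMono w → StrictMono z →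
      P.Forms (univ.image w) (univ.image z) → ∃ φ : Fin (2 * r) ↪o V,
        ((∀ i, w i = φ (A.orderEmbOfFin hA i)) ∧ ∀ i, z i = φ (B.orderEmbOfFin hB i)) ∨
        ((∀ i, w i = φ (B.orderEmbOfFin hB i)) ∧ ∀ i, z i = φ (A.orderEmbOfFin hA i)) := by
    rintro w z hw hz ⟨φ, hφ⟩
    refine ⟨φ, ?_⟩
    rw [hAB, image_insert, image_singleton] at hφ
    have hφ' : ({A.map φ.toEmbedding, B.map φ.toEmbedding} : Set (Finset V)) =
        {univ.image w, univ.image z} := by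
      rw [← coe_pair, ← coe_pair, hφ]
    rcases Set.pair_eq_pair_iff.1 hφ' with ⟨h1, h2⟩ | ⟨h1, h2⟩
    · exact Or.inl ⟨eq_comp_of_map_eq hA hw h1, eq_comp_of_map_eq hB hz h2⟩
    · exact Or.inr ⟨eq_comp_of_map_eq hB hw h2, eq_comp_of_map_eq hA hz h1⟩
  obtain ⟨φ, hφ⟩ := key u v hu hv h
  obtain ⟨ψ, hψ⟩ := key u' v' hu' hv' h'
  rcases hφ with ⟨h1, h2⟩ | ⟨h1, h2⟩ <;> rcases hψ with ⟨h3, h4⟩ | ⟨h3, h4⟩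
  · exact Or.inl fun i j => by simp [h1, h2, h3, h4]
  · exact Or.inr fun i j => by simp [h1, h2, h3, h4]
  · exact Or.inr fun i j => by simp [h1, h2, h3, h4]
  · exact Or.inl fun i j => by simp [h1, h2, h3, h4]

/-! ### Orders with bounded chains -/

/-- Mirsky's theorem, as a labelling: the label of `a` is the largest size of a chain strictly
below `a`. -/
theorem exists_label_of_chain_card_le {S : Finset ι} {R : ι → ι → Prop} {m : ℕ}
    (hirr : ∀ a, ¬ R a a) (htrans : ∀ a b c, R a b → R b c → R a c)
    (hm : ∀ c ⊆ S, (∀ a ∈ c, ∀ b ∈ c, a ≠ b → R a b ∨ R b a) → c.card ≤ m) :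
    ∃ h : ι → ℕ, (∀ a ∈ S, h a < m) ∧ ∀ a ∈ S, ∀ b, R a b → h a < h b := by
  classical
  let F : ι → Finset (Finset ι) := fun a => S.powerset.filter fun c =>
    (∀ b ∈ c, R b a) ∧ ∀ b ∈ c, ∀ d ∈ c, b ≠ d → R b d ∨ R d b
  have hF : ∀ a c, c ∈ F a ↔ c ⊆ S ∧ (∀ b ∈ c, R b a) ∧
      ∀ b ∈ c, ∀ d ∈ c, b ≠ d → R b d ∨ R d b := by
    intro a c
    simp [F]
  have hne : ∀ a, (F a).Nonempty := fun a => ⟨∅, by simp [hF]⟩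
  have hins : ∀ a ∈ S, ∀ c ∈ F a, insert a c ⊆ S ∧ (insert a c).card = c.card + 1 ∧
      ∀ b ∈ insert a c, ∀ d ∈ insert a c, b ≠ d → R b d ∨ R d b := by
    intro a ha c hc
    obtain ⟨h1, h2, h3⟩ := (hF a c).1 hc
    refine ⟨insert_subset ha h1, card_insert_of_notMem fun hac => hirr a (h2 a hac), ?_⟩
    intro b hb d hd hbd
    rcases mem_insert.1 hb with hb | hb <;> rcases mem_insert.1 hd with hd | hd
    · exact absurd (hb.trans hd.symm) hbd
    · exact Or.inr (hb ▸ h2 d hd)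
    · exact Or.inl (hd ▸ h2 b hb)
    · exact h3 b hb d hd hbd
  refine ⟨fun a => (F a).sup card, fun a ha => ?_, fun a ha b hab => ?_⟩
  · obtain ⟨c, hc, hcs⟩ := exists_mem_eq_sup (F a) (hne a) card
    obtain ⟨h1, h2, h3⟩ := hins a ha c hc
    have := hm _ h1 h3
    simp only [hcs]
    omega
  · obtain ⟨c, hc, hcs⟩ := exists_mem_eq_sup (F a) (hne a) card
    obtain ⟨h1, h2, h3⟩ := hins a ha c hc
    have hmem : insert a c ∈ F b := by
      refine (hF b _).2 ⟨h1, fun d hd => ?_, h3⟩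
      rcases mem_insert.1 hd with rfl | hd
      · exact hab
      · exact htrans _ _ _ (((hF a c).1 hc).2.1 d hd) hab
    have := le_sup (f := card) hmem
    simp only [hcs]
    omega

theorem exists_antichain_of_chain_card_le {κ : Type*} (T : Finset κ) (S : Finset ι)
    {R : κ → ι → ι → Prop} {m : ℕ} (hirr : ∀ t ∈ T, ∀ a, ¬ R t a a)
    (htrans : ∀ t ∈ T, ∀ a b c, R t a b → R t b c → R t a c)
    (hm : ∀ t ∈ T, ∀ c ⊆ S, (∀ a ∈ c, ∀ b ∈ c, a ≠ b → R t a b ∨ R t b a) → c.card ≤ m) :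
    ∃ A ⊆ S, S.card ≤ m ^ T.card * A.card ∧ ∀ t ∈ T, ∀ a ∈ A, ∀ b ∈ A, ¬ R t a b := by
  classical
  induction T using Finset.induction_on with
  | empty => exact ⟨S, Subset.rfl, by simp, by simp⟩
  | insert t T ht ih =>
    obtain ⟨A, hAS, hcard, hA⟩ := ih (fun s hs => hirr s (mem_insert_of_mem hs))
      (fun s hs => htrans s (mem_insert_of_mem hs)) (fun s hs => hm s (mem_insert_of_mem hs))
    have htT := mem_insert_self t T
    obtain ⟨h, hlt, hmono⟩ := exists_label_of_chain_card_le (S := A) (hirr t htT) (htrans t htT)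
      (fun c hc => hm t htT c (hc.trans hAS))
    rcases A.eq_empty_or_nonempty with rfl | ⟨a, ha⟩
    · exact ⟨∅, empty_subset _, by simpa using hcard, by simp⟩
    have hmpos : 0 < m := (Nat.zero_le _).trans_lt (hlt a ha)
    obtain ⟨k, hk, hkcard⟩ := exists_max_image (range m)
      (fun k => (A.filter fun a => h a = k).card) ⟨0, mem_range.2 hmpos⟩
    refine ⟨A.filter fun a => h a = k, (filter_subset _ _).trans hAS, ?_, ?_⟩
    · have h1 : A.card ≤ m * (A.filter fun a => h a = k).card := by
        have := card_le_mul_card_image_of_maps_to (f := h) (s := A) (t := range m)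
          (fun a ha => mem_range.2 (hlt a ha)) _ (fun j hj => hkcard j hj)
        rw [card_range] at this
        linarith
      rw [card_insert_of_notMem ht, pow_succ, mul_assoc]
      exact hcard.trans (Nat.mul_le_mul_left _ h1)
    · intro s hs a ha b hb hab
      rw [mem_filter] at ha hb
      rcases mem_insert.1 hs with rfl | hs
      · have := hmono a ha.1 b hab
        omega
      · exact hA s hs a ha.1 b hb.1 hab

/-! ### Interlacings with prescribed cuts -/

/-- No cut of `D` separates the positions `i` and `j`; the cut `d` lies between the positions
`d` and `d + 1`. -/
def SameBlock (D : Finset ℕ) (i j : ℕ) : Prop := ∀ d ∈ D, d < i ↔ d < j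

/-- The sign of position `i`, when the sign is positive at `0` and changes exactly at the
cuts of `t`. -/
def Ahead (t : Finset ℕ) (i : ℕ) : Prop := Even (t.filter (· < i)).card

/-- In each block of positions cut out by `D`, one of the edges `u`, `v` lies entirely before the
other: `u` in the blocks of positive sign, `v` in the remaining ones. -/
def Precedes (D t : Finset ℕ) (u v : Fin r → V) : Prop :=
  ∀ i j : Fin r, SameBlock D i j → (Ahead t i → u i < v j) ∧ (¬ Ahead t i → v i < u j)

/-- For each `d ∈ D`, some threshold has the vertices in positions at most `d` of all edges in `S`
below it and the vertices in later positions above it. -/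
def HasCuts (x : ι → Fin r → V) (S : Finset ι) (D : Finset ℕ) : Prop :=
  ∀ e ∈ S, ∀ f ∈ S, ∀ d ∈ D, ∀ i j : Fin r, (i : ℕ) ≤ d → d < j → x e i < x f j

/-- The first vertex of `v` in the block of position `d` lies between the vertices of `u` in the
positions `d` and `d + 1`. -/
def Crosses (D : Finset ℕ) (d : ℕ) (u v : Fin r → V) : Prop :=
  ∃ hd : d + 1 < r, (∀ i : Fin r, SameBlock D i d → u ⟨d, Nat.lt_of_succ_lt hd⟩ < v i) ∧
    ∃ i : Fin r, SameBlock D i d ∧ v i < u ⟨d + 1, hd⟩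

theorem SameBlock.refl (D : Finset ℕ) (i : ℕ) : SameBlock D i i := fun _ _ => Iff.rfl

theorem SameBlock.symm {D : Finset ℕ} {i j : ℕ} (h : SameBlock D i j) : SameBlock D j i :=
  fun d hd => (h d hd).symm

theorem SameBlock.trans {D : Finset ℕ} {i j k : ℕ} (h : SameBlock D i j) (h' : SameBlock D j k) :
    SameBlock D i k := fun d hd => (h d hd).trans (h' d hd)

theorem SameBlock.ahead_iff {D t : Finset ℕ} (ht : t ⊆ D) {i j : ℕ} (h : SameBlock D i j) :
    Ahead t i ↔ Ahead t j := by
  unfold Ahead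
  rw [filter_congr fun d hd => h d (ht hd)]

theorem ahead_zero (t : Finset ℕ) : Ahead t 0 := by simp [Ahead]

theorem ahead_succ (t : Finset ℕ) (i : ℕ) : Ahead t (i + 1) ↔ (i ∈ t ↔ ¬ Ahead t i) := by
  unfold Ahead
  by_cases hi : i ∈ t
  · have : t.filter (· < i + 1) = insert i (t.filter (· < i)) := by
      ext d
      simp only [mem_filter, mem_insert]
      constructor
      · rintro ⟨hd, hdi⟩
        rcases Nat.lt_succ_iff_lt_or_eq.1 hdi with h | h
        · exact Or.inr ⟨hd, h⟩
        · exact Or.inl h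
      · rintro (rfl | ⟨hd, hdi⟩)
        · exact ⟨hi, Nat.lt_succ_self _⟩
        · exact ⟨hd, by omega⟩
    rw [this, card_insert_of_notMem (by simp), Nat.even_add_one]
    simp [hi]
  · have : t.filter (· < i + 1) = t.filter (· < i) := by
      refine filter_congr fun d hd => ?_
      have : d ≠ i := fun h => hi (h ▸ hd)
      omega
    rw [this]
    simp [hi]

theorem not_precedes_self (hr : 0 < r) (D t : Finset ℕ) (u : Fin r → V) : ¬ Precedes D t u u :=
  fun h => lt_irrefl _ ((h ⟨0, hr⟩ ⟨0, hr⟩ (SameBlock.refl _ _)).1 (ahead_zero t))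

theorem Precedes.trans {D t : Finset ℕ} {u v w : Fin r → V} (h : Precedes D t u v)
    (h' : Precedes D t v w) : Precedes D t u w := fun i j hij =>
  ⟨fun ha => ((h i i (SameBlock.refl _ _)).1 ha).trans ((h' i j hij).1 ha),
    fun ha => ((h' i i (SameBlock.refl _ _)).2 ha).trans ((h i j hij).2 ha)⟩

theorem HasCuts.mono {x : ι → Fin r → V} {S S' : Finset ι} {D : Finset ℕ} (h : HasCuts x S D)
    (hS : S' ⊆ S) : HasCuts x S' D := fun e he f hf => h e (hS he) f (hS hf)

/-- The cuts and the signs determine how two edges are interlaced. -/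
theorem sameOrder_of_precedes {x : ι → Fin r → V} {S : Finset ι} {D t : Finset ℕ} (ht : t ⊆ D)
    (hS : HasCuts x S D) {e f e' f' : ι} (he : e ∈ S) (hf : f ∈ S) (he' : e' ∈ S) (hf' : f' ∈ S)
    (h : Precedes D t (x e) (x f)) (h' : Precedes D t (x e') (x f')) :
    SameOrder (x e) (x f) (x e') (x f') := by
  intro i j
  by_cases hij : SameBlock D i j
  · by_cases ha : Ahead t i
    · have ha' := (hij.ahead_iff ht).1 ha
      exact ⟨iff_of_true ((h i j hij).1 ha) ((h' i j hij).1 ha),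
        iff_of_false ((h j i hij.symm).1 ha').not_gt ((h' j i hij.symm).1 ha').not_gt⟩
    · have ha' := mt (hij.ahead_iff ht).2 ha
      exact ⟨iff_of_false ((h j i hij.symm).2 ha').not_gt ((h' j i hij.symm).2 ha').not_gt,
        iff_of_true ((h i j hij).2 ha) ((h' i j hij).2 ha)⟩
  · obtain ⟨d, hd, hdij⟩ : ∃ d ∈ D, ¬ ((d < i) ↔ (d < j)) := by
      simpa [SameBlock] using hij
    by_cases hdi : d < i
    · have hdj : (j : ℕ) ≤ d := by
        by_contra hcon
        exact hdij (iff_of_true hdi (not_le.1 hcon))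
      exact ⟨iff_of_false (hS f hf e he d hd j i hdj hdi).not_gt
        (hS f' hf' e' he' d hd j i hdj hdi).not_gt,
        iff_of_false (hS e he f hf d hd j i hdj hdi).not_gt
        (hS e' he' f' hf' d hd j i hdj hdi).not_gt⟩
    · have hdj : d < j := by
        by_contra hcon
        exact hdij (iff_of_false hdi hcon)
      have hid := not_lt.1 hdi
      exact ⟨iff_of_true (hS e he f hf d hd i j hid hdj) (hS e' he' f' hf' d hd i j hid hdj),
        iff_of_true (hS f hf e he d hd i j hid hdj) (hS f' hf' e' he' d hd i j hid hdj)⟩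

/-- If `u` enters a block before `v` and no vertex gap of `u` contains the first vertex of `v` in
the block, then `u` also leaves the block before `v` enters. -/
theorem lt_of_not_crosses {D : Finset ℕ} {u v : Fin r → V} (hv : StrictMono v)
    (huv : ∀ i j, u i ≠ v j) (hD : ∀ d ∉ D, ¬ Crosses D d u v) {a : ℕ} (ha : a < r)
    (hmin : ∀ i, SameBlock D i a → a ≤ i) (hlt : u ⟨a, ha⟩ < v ⟨a, ha⟩) (j : ℕ) (haj : a ≤ j) :
    ∀ hj : j < r, SameBlock D j a → u ⟨j, hj⟩ < v ⟨a, ha⟩ := by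
  induction j, haj using Nat.le_induction with
  | base => exact fun _ _ => hlt
  | succ j haj ih =>
    intro hj hja
    have hja' : SameBlock D j a := fun d hd => by
      have := hja d hd
      omega
    have hjD : j ∉ D := fun hd => by
      have := hja j hd
      omega
    by_contra hcon
    refine hD j hjD ⟨hj, fun i hi => (ih (by omega) hja').trans_le (hv.monotone ?_),
      ⟨a, ha⟩, hja'.symm, lt_of_le_of_ne (not_lt.1 hcon) (huv _ _).symm⟩
    exact hmin i (hi.trans hja')

theorem forall_lt_or_forall_lt_of_not_crosses {D : Finset ℕ} {u v : Fin r → V} (hu : StrictMono u)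
    (hv : StrictMono v) (huv : ∀ i j, u i ≠ v j) (hD : ∀ d ∉ D, ¬ Crosses D d u v)
    (hD' : ∀ d ∉ D, ¬ Crosses D d v u) (i : Fin r) :
    (∀ j k : Fin r, SameBlock D j i → SameBlock D k i → u j < v k) ∨
      ∀ j k : Fin r, SameBlock D j i → SameBlock D k i → v j < u k := by
  classical
  have hex : ∃ a, SameBlock D a i := ⟨i, SameBlock.refl _ _⟩
  obtain ⟨a, hai, hmin⟩ : ∃ a, SameBlock D a i ∧ ∀ j, SameBlock D j a → a ≤ j :=
    ⟨Nat.find hex, Nat.find_spec hex,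
      fun j hj => Nat.find_min' hex (hj.trans (Nat.find_spec hex))⟩
  have ha : a < r := (hmin i hai.symm).trans_lt i.2
  rcases lt_or_gt_of_ne (huv ⟨a, ha⟩ ⟨a, ha⟩) with h | h
  · refine Or.inl fun j k hj hk => ?_
    have hj' := hj.trans hai.symm
    have hk' := hk.trans hai.symm
    exact (lt_of_not_crosses hv huv hD ha hmin h j (hmin j hj') j.2 hj').trans_le
      (hv.monotone (hmin k hk'))
  · refine Or.inr fun j k hj hk => ?_
    have hj' := hj.trans hai.symm
    have hk' := hk.trans hai.symm
    exact (lt_of_not_crosses hu (fun i j => (huv j i).symm) hD' ha hmin h j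
      (hmin j hj') j.2 hj').trans_le (hu.monotone (hmin k hk'))

/-- Two edges that are incomparable for all sign choices have intersecting blocks, so that a block
of one starts inside a block of the other. -/
theorem exists_crosses_of_not_precedes (hr : 0 < r) {D : Finset ℕ} {u v : Fin r → V}
    (hu : StrictMono u) (hv : StrictMono v) (huv : ∀ i j, u i ≠ v j)
    (h : ∀ t ∈ D.powerset, ¬ Precedes D t u v ∧ ¬ Precedes D t v u) :
    ∃ d ∉ D, Crosses D d u v ∨ Crosses D d v u := by
  classical
  by_contra! hcon
  have hblock := forall_lt_or_forall_lt_of_not_crosses hu hv huv (fun d hd => (hcon d hd).1)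
    (fun d hd => (hcon d hd).2)
  have hor : ∀ i j : Fin r, SameBlock D i j → (u i < v i → u i < v j) ∧
      (¬ u i < v i → v i < u j) := by
    intro i j hij
    have hi := SameBlock.refl D i
    rcases hblock i with hb | hb
    · exact ⟨fun _ => hb i j hi hij.symm, fun hn => absurd (hb i i hi hi) hn⟩
    · exact ⟨fun hn => absurd hn (hb i i hi hi).not_gt, fun _ => hb i j hi hij.symm⟩
  let t := D.filter fun d => ∃ hd : d + 1 < r,
    ¬ (u ⟨d, Nat.lt_of_succ_lt hd⟩ < v ⟨d, Nat.lt_of_succ_lt hd⟩ ↔ u ⟨d + 1, hd⟩ < v ⟨d + 1, hd⟩)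
  have hsign : ∀ i (hi : i < r),
      (u ⟨i, hi⟩ < v ⟨i, hi⟩ ↔ (Ahead t i ↔ u ⟨0, hr⟩ < v ⟨0, hr⟩)) := by
    intro i
    induction i with
    | zero => simp [ahead_zero]
    | succ i ih =>
      intro hi
      have ih' := ih (Nat.lt_of_succ_lt hi)
      have hit : i ∈ t ↔ ¬ (u ⟨i, Nat.lt_of_succ_lt hi⟩ < v ⟨i, Nat.lt_of_succ_lt hi⟩ ↔
          u ⟨i + 1, hi⟩ < v ⟨i + 1, hi⟩) := by
        simp only [t, mem_filter, hi, exists_true_left, and_iff_right_iff_imp]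
        intro hne
        by_contra hiD
        -- without a cut after `i`, both positions lie in the same block
        have hs : SameBlock D (⟨i, Nat.lt_of_succ_lt hi⟩ : Fin r) (⟨i + 1, hi⟩ : Fin r) := by
          intro d hd
          have : d ≠ i := fun h => hiD (h ▸ hd)
          simp only
          omega
        apply hne
        rcases hblock ⟨i, Nat.lt_of_succ_lt hi⟩ with hb | hb
        · exact iff_of_true (hb _ _ (SameBlock.refl _ _) (SameBlock.refl _ _))
            (hb _ _ hs.symm hs.symm)
        · exact iff_of_false (hb _ _ (SameBlock.refl _ _) (SameBlock.refl _ _)).not_gt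
            (hb _ _ hs.symm hs.symm).not_gt
      rw [ahead_succ]
      tauto
  have ht : t ∈ D.powerset := mem_powerset.2 (filter_subset _ _)
  by_cases h0 : u ⟨0, hr⟩ < v ⟨0, hr⟩
  · refine (h t ht).1 fun i j hij => ?_
    have hs := hsign i i.2
    have ho := hor i j hij
    exact ⟨fun ha => ho.1 (hs.2 (by tauto)), fun ha => ho.2 fun hlt => ha ((hs.1 hlt).2 h0)⟩
  · refine (h t ht).2 fun i j hij => ?_
    have hs := hsign i i.2
    have ho := hor i j hij
    exact ⟨fun ha => ho.2 fun hlt => h0 ((hs.1 hlt).1 ha), fun ha => ho.1 (hs.2 (by tauto))⟩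

/-- The edges that contain the first vertex of a fixed block of `f` between their positions `d` and
`d + 1` have a common cut at `d`. -/
theorem HasCuts.insert_of_crosses {x : ι → Fin r → V} {S : Finset ι} {D : Finset ℕ} {d : ℕ}
    {v : Fin r → V} (hx : ∀ e, StrictMono (x e)) (hS : HasCuts x S D)
    (h : ∀ e ∈ S, Crosses D d (x e) v) : HasCuts x S (insert d D) := by
  intro e he f hf d' hd' i j hi hj
  rcases mem_insert.1 hd' with rfl | hd'
  · obtain ⟨hd, h1, -⟩ := h e he
    obtain ⟨_, -, k, hk, h2⟩ := h f hf
    exact ((hx e).monotone (show i ≤ ⟨d', Nat.lt_of_succ_lt hd⟩ from hi)).trans_lt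
      ((h1 k hk).trans (h2.trans_le ((hx f).monotone (show ⟨d' + 1, hd⟩ ≤ j from hj))))
  · exact hS e he f hf d' hd' i j hi hj

/-- Each unordered pair in `A` is charged to an element of `A × G`, which receives at most `q`
pairs; so the number `#A * (#A - 1)` of ordered pairs is at most `2 * q * #A * #G`. -/
theorem card_le_of_forall_pair_charged {A : Finset ι} {κ : Type*} {G : Finset κ}
    {Q : κ → ι → ι → Prop} {q : ℕ}
    (hQ : ∀ a ∈ A, ∀ b ∈ A, a ≠ b → ∃ d ∈ G, Q d a b ∨ Q d b a)
    (hq : ∀ d ∈ G, ∀ b ∈ A, ∀ E ⊆ A, (∀ a ∈ E, Q d a b) → E.card ≤ q) :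
    A.card ≤ G.card * (2 * q) + 1 := by
  classical
  let E : ι × κ → Finset ι := fun p => A.filter fun a => Q p.2 a p.1
  have hsub : A.offDiag ⊆ (A ×ˢ G).biUnion fun p => E p ×ˢ {p.1} ∪ {p.1} ×ˢ E p := by
    rintro ⟨a, b⟩ hab
    obtain ⟨ha, hb, hne⟩ := mem_offDiag.1 hab
    obtain ⟨d, hd, h | h⟩ := hQ a ha b hb hne
    · exact mem_biUnion.2 ⟨(b, d), mem_product.2 ⟨hb, hd⟩, by simp [E, ha, h]⟩
    · exact mem_biUnion.2 ⟨(a, d), mem_product.2 ⟨ha, hd⟩, by simp [E, hb, h]⟩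
  have h1 := (card_le_card hsub).trans (card_biUnion_le_card_mul _ _ (2 * q) fun p hp => by
    obtain ⟨hp1, hp2⟩ := mem_product.1 hp
    have := hq p.2 hp2 p.1 hp1 (E p) (filter_subset _ _) fun a ha => (mem_filter.1 ha).2
    refine (card_union_le _ _).trans ?_
    simp only [card_product, card_singleton]
    omega)
  rw [offDiag_card, card_product] at h1
  rcases Nat.eq_zero_or_pos A.card with h0 | h0
  · omega
  · have h2 : A.card * A.card ≤ A.card * (G.card * (2 * q) + 1) := by
      rw [mul_add, mul_one, ← mul_assoc]
      omega
    exact Nat.le_of_mul_le_mul_left h2 h0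

open scoped Nat in
/-- The lower bound for families with a given set of cuts, by induction on the number `K` of
positions that remain to be cut. -/
theorem card_le_of_hasCuts (hr : 0 < r) {m : ℕ} {x : ι → Fin r → V} (hx : ∀ e, StrictMono (x e))
    (hdisj : ∀ e f, e ≠ f → ∀ i j, x e i ≠ x f j)
    (hm : ∀ (D t : Finset ℕ) (c : Finset ι), t ⊆ D → HasCuts x c D →
      (∀ e ∈ c, ∀ f ∈ c, e ≠ f → Precedes D t (x e) (x f) ∨ Precedes D t (x f) (x e)) →
      c.card ≤ m) (K : ℕ) :
    ∀ (D : Finset ℕ) (S : Finset ι), D ⊆ range (r - 1) → D.card + K = r - 1 → HasCuts x S D →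
      S.card ≤ (2 * K + 1)‼ * m ^ (2 ^ r - 2 ^ D.card) := by
  classical
  induction K with
  | zero =>
    intro D S hD hK hS
    obtain ⟨A, hAS, hA, hanti⟩ := exists_antichain_of_chain_card_le D.powerset S
      (R := fun t a b => Precedes D t (x a) (x b)) (fun t _ a => not_precedes_self hr D t (x a))
      (fun t _ a b c => Precedes.trans)
      (fun t ht c hc => hm D t c (mem_powerset.1 ht) (hS.mono hc))
    have hDr : D = range (r - 1) := eq_of_subset_of_card_le hD (by rw [card_range]; omega)
    have hA1 : A.card ≤ 1 := by
      refine card_le_one.2 fun a ha b hb => ?_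
      by_contra hab
      obtain ⟨d, hd, h⟩ := exists_crosses_of_not_precedes hr (hx a) (hx b) (hdisj a b hab)
        fun t ht => ⟨hanti t ht a ha b hb, hanti t ht b hb a ha⟩
      have hdr : d + 1 < r := h.elim (fun h => h.1) fun h => h.1
      exact hd (hDr ▸ mem_range.2 (by omega))
    have he : 2 ^ r - 2 ^ D.card = 2 ^ D.card := by
      have : r = D.card + 1 := by omega
      rw [this, pow_succ]
      omega
    rw [he]
    rw [card_powerset] at hA
    simpa using hA.trans (Nat.mul_le_mul_left _ hA1)
  | succ K ih =>
    intro D S hD hK hS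
    rcases S.eq_empty_or_nonempty with rfl | ⟨s, hs⟩
    · simp
    have hmpos : 0 < m := by
      have := hm D ∅ {s} (empty_subset _) (hS.mono (singleton_subset_iff.2 hs))
        (fun e he f hf hef => absurd ((mem_singleton.1 he).trans (mem_singleton.1 hf).symm) hef)
      exact (card_singleton s).symm.trans_le this
    obtain ⟨A, hAS, hA, hanti⟩ := exists_antichain_of_chain_card_le D.powerset S
      (R := fun t a b => Precedes D t (x a) (x b)) (fun t _ a => not_precedes_self hr D t (x a))
      (fun t _ a b c => Precedes.trans)
      (fun t ht c hc => hm D t c (mem_powerset.1 ht) (hS.mono hc))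
    have hG : (range (r - 1) \ D).card = K + 1 := by
      rw [card_sdiff_of_subset hD, card_range]
      omega
    have hA2 := card_le_of_forall_pair_charged (A := A) (G := range (r - 1) \ D)
      (Q := fun d a b => Crosses D d (x a) (x b))
      (q := (2 * K + 1)‼ * m ^ (2 ^ r - 2 ^ (D.card + 1)))
      (fun a ha b hb hab => by
        obtain ⟨d, hd, h⟩ := exists_crosses_of_not_precedes hr (hx a) (hx b) (hdisj a b hab)
          fun t ht => ⟨hanti t ht a ha b hb, hanti t ht b hb a ha⟩
        have hdr : d + 1 < r := h.elim (fun h => h.1) fun h => h.1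
        exact ⟨d, mem_sdiff.2 ⟨mem_range.2 (by omega), hd⟩, h⟩)
      (fun d hd b hb E hE h => by
        obtain ⟨hdr, hdD⟩ := mem_sdiff.1 hd
        have hc := card_insert_of_notMem hdD
        rw [← hc]
        exact ih (insert d D) E (insert_subset hdr hD) (by omega)
          ((hS.mono (hE.trans hAS)).insert_of_crosses hx h))
    rw [hG] at hA2
    have hq : 1 ≤ (2 * K + 1)‼ * m ^ (2 ^ r - 2 ^ (D.card + 1)) :=
      Nat.mul_pos (Nat.doubleFactorial_pos _) (pow_pos hmpos _)
    have he : 2 ^ r - 2 ^ D.card = 2 ^ D.card + (2 ^ r - 2 ^ (D.card + 1)) := by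
      have : 2 ^ (D.card + 1) ≤ 2 ^ r := Nat.pow_le_pow_right (by norm_num) (by omega)
      rw [pow_succ] at *
      omega
    rw [card_powerset] at hA
    calc S.card ≤ m ^ 2 ^ D.card * A.card := hA
      _ ≤ m ^ 2 ^ D.card * ((2 * K + 3) *
          ((2 * K + 1)‼ * m ^ (2 ^ r - 2 ^ (D.card + 1)))) := by
        refine Nat.mul_le_mul_left _ (hA2.trans ?_)
        nlinarith
      _ = (2 * (K + 1) + 1)‼ * m ^ (2 ^ r - 2 ^ D.card) := by
        rw [he, pow_add, show 2 * (K + 1) + 1 = 2 * K + 1 + 2 by ring, Nat.doubleFactorial_add_two]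
        ring

open scoped Nat in
theorem size_le_mul_maxClique_pow (hr : 0 < r) (M : OrderedMatching r V) :
    M.size ≤ (2 * r - 1)‼ * M.maxClique ^ (2 ^ r - 1) := by
  classical
  let x : {e // e ∈ M.edges} → Fin r → V := fun e => e.1.orderEmbOfFin (M.card_of_mem_edges e.1 e.2)
  have hx : ∀ e, StrictMono (x e) := fun e => OrderEmbedding.strictMono _
  have himage : ∀ e, univ.image (x e) = e.1 := fun e => image_orderEmbOfFin_univ _ _
  have hmem : ∀ e i, x e i ∈ e.1 := fun e i => orderEmbOfFin_mem _ _ _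
  have hdisj : ∀ e f, e ≠ f → ∀ i j, x e i ≠ x f j := by
    intro e f hef i j hij
    obtain ⟨g, -, hg⟩ := M.existsUnique_edge (x e i)
    exact hef (Subtype.ext ((hg e.1 ⟨e.2, hmem e i⟩).trans
      (hg f.1 ⟨f.2, hij ▸ hmem f j⟩).symm))
  have hm : ∀ (D t : Finset ℕ) (c : Finset {e // e ∈ M.edges}), t ⊆ D → HasCuts x c D →
      (∀ e ∈ c, ∀ f ∈ c, e ≠ f → Precedes D t (x e) (x f) ∨ Precedes D t (x f) (x e)) →
      c.card ≤ M.maxClique := by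
    intro D t c ht hc hchain
    obtain ⟨P, hP⟩ : ∃ P : MatchingPattern r, ∀ e ∈ c, ∀ f ∈ c, Precedes D t (x e) (x f) →
        P.Forms e.1 f.1 := by
      by_cases h : ∃ e ∈ c, ∃ f ∈ c, Precedes D t (x e) (x f)
      · obtain ⟨e, he, f, hf, hef⟩ := h
        have hne : e ≠ f := by
          rintro rfl
          exact not_precedes_self hr D t (x e) hef
        obtain ⟨P, hP⟩ := exists_forall_forms hr (hx e) (hx f) (hdisj e f hne)
        refine ⟨P, fun e' he' f' hf' h' => ?_⟩
        rw [← himage e', ← himage f']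
        exact hP _ _ (hx e') (hx f') (sameOrder_of_precedes ht hc he hf he' hf' hef h')
      · exact ⟨patternOfEquiv hr (Fintype.equivOfCardEq (by simp)),
          fun e he f hf hef => absurd ⟨e, he, f, hf, hef⟩ h⟩
    have hcl : P.IsClique (c.map (Embedding.subtype _)) := by
      intro e he f hf hef
      obtain ⟨e, hec, rfl⟩ := mem_map.1 he
      obtain ⟨f, hfc, rfl⟩ := mem_map.1 hf
      rcases hchain e hec f hfc (fun h => hef (h ▸ rfl)) with h | h
      · exact hP e hec f hfc h
      · obtain ⟨g, hg⟩ := hP f hfc e hec h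
        exact ⟨g, hg.trans (pair_comm _ _)⟩
    refine le_trans ?_ (M.cliqueNumber_le_maxClique P)
    rw [← card_map (Embedding.subtype _)]
    refine le_sup (f := card) (mem_filter.2 ⟨mem_powerset.2 fun e he => ?_, hcl⟩)
    obtain ⟨e, -, rfl⟩ := mem_map.1 he
    exact e.2
  have := card_le_of_hasCuts hr hx hdisj hm (r - 1) ∅ univ (empty_subset _) (by simp)
    (fun e _ f _ d hd => absurd hd (notMem_empty d))
  rw [card_univ, Fintype.card_coe, card_empty, pow_zero,
    show 2 * (r - 1) + 1 = 2 * r - 1 by omega] at this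
  exact this

/-! ### Matchings with small cliques -/

theorem maxClique_ofEquiv_le [Fintype ι] (hr : 0 < r) {m : ℕ} {x : ι → Fin r → W}
    (hx : ∀ a, StrictMono (x a)) {ρ : ι × Fin r ≃ V}
    (hρ : ∀ a b, ρ a < ρ b ↔ x a.1 a.2 < x b.1 b.2)
    (hm : ∀ T : Finset ι, (∀ a ∈ T, ∀ b ∈ T, ∀ a' ∈ T, ∀ b' ∈ T, a ≠ b → a' ≠ b' →
      SameOrder (x a) (x b) (x a') (x b') ∨ SameOrder (x a) (x b) (x b') (x a')) → T.card ≤ m) :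
    (ofEquiv ρ).maxClique ≤ m := by
  classical
  refine ciSup_le' fun P => Finset.sup_le fun S hS => ?_
  obtain ⟨hSM, hcl⟩ := mem_filter.1 hS
  rw [mem_powerset] at hSM
  let T : Finset ι := univ.filter fun a => (univ.image fun i => ρ (a, i)) ∈ S
  have hST : S ⊆ T.image fun a => univ.image fun i => ρ (a, i) := by
    intro e he
    obtain ⟨a, -, rfl⟩ := mem_image.1 (hSM he)
    exact mem_image_of_mem (fun a => univ.image fun i => ρ (a, i)) (by simpa [T] using he)
  refine (card_le_card hST).trans (card_image_le.trans (hm T ?_))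
  have hmono : ∀ a, StrictMono fun i => ρ (a, i) := fun a i j hij => (hρ _ _).2 (hx a hij)
  have hforms : ∀ a ∈ T, ∀ b ∈ T, a ≠ b →
      P.Forms (univ.image fun i => ρ (a, i)) (univ.image fun i => ρ (b, i)) :=
    fun a ha b hb hab => hcl _ (mem_filter.1 ha).2 _ (mem_filter.1 hb).2
      fun h => hab (injective_edge_ofEquiv hr ρ h)
  intro a ha b hb a' ha' b' hb' hab hab'
  have := sameOrder_or_swap_of_forms (hmono a) (hmono b) (hmono a') (hmono b')
    (hforms a ha b hb hab) (hforms a' ha' b' hb' hab')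
  simpa only [SameOrder, hρ] using this

/-- The number of cuts of coordinate `c`: these are the cuts `0, …, level c - 1`. The coordinates
of level `k` are `2 ^ k - 1, …, 2 ^ (k + 1) - 2`. -/
def level (c : ℕ) : ℕ := Nat.log 2 (c + 1)

/-- The sign that coordinate `c` gives to its block `b`: positive on the block `0`, and read off
from the binary digits of `c + 1` on the others. -/
def Positive (c b : ℕ) : Prop := b = 0 ∨ (c + 1).testBit (b - 1) = true

open Classical in
/-- The entry at `c` of the key of a vertex in position `i` of an edge with coordinate `z < m` at
`c`. The first term, the block of `i`, dominates. -/
noncomputable def entry (m c i z : ℕ) : ℤ :=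
  2 * m * (min i (level c) : ℕ) + if Positive c (min i (level c)) then (z : ℤ) else -z

/-- The key of the vertex in position `i` of the edge `x`. The vertices are ordered by their keys,
compared lexicographically. -/
noncomputable def key {m : ℕ} (x : Fin (2 ^ r - 1) → Fin m) (i : Fin r) :
    Lex (Fin (2 ^ r - 1) → ℤ) :=
  toLex fun c => entry m c i (x c)

theorem level_mono : Monotone level := fun _ _ h => Nat.log_mono_right (Nat.succ_le_succ h)

theorem level_lt (c : Fin (2 ^ r - 1)) : level c < r :=
  Nat.log_lt_of_lt_pow (by omega) (by have := c.2; omega)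

theorem eq_of_level_eq {c c' : ℕ} (hl : level c = level c')
    (hp : ∀ b ≤ level c, Positive c b ↔ Positive c' b) : c = c' := by
  have htop : ∀ c, (c + 1).testBit (level c) = true ∧ ∀ b, level c < b →
      (c + 1).testBit b = false := by
    intro c
    have h1 : 2 ^ level c ≤ c + 1 := Nat.pow_log_le_self 2 (by omega)
    have h2 : c + 1 < 2 ^ (level c + 1) := Nat.lt_pow_succ_log_self (by norm_num) _
    refine ⟨?_, fun b hb => Nat.testBit_lt_two_pow
      (h2.trans_le (Nat.pow_le_pow_right (by norm_num) hb))⟩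
    have h3 : (c + 1) / 2 ^ level c = 1 :=
      Nat.div_eq_of_lt_le (by omega) (by rw [pow_succ] at h2; omega)
    rw [Nat.testBit_eq_decide_div_mod_eq, h3]
    rfl
  refine Nat.succ_injective (Nat.eq_of_testBit_eq fun b => ?_)
  rcases lt_trichotomy b (level c) with hb | rfl | hb
  · have := hp (b + 1) hb
    simp only [Positive, Nat.succ_ne_zero, false_or, Nat.add_sub_cancel] at this
    exact Bool.eq_iff_iff.2 this
  · exact (htop c).1.trans (hl ▸ (htop c').1).symm
  · exact ((htop c).2 b hb).trans ((htop c').2 b (hl ▸ hb)).symm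

theorem entry_lt_of_min_lt {m c i j z z' : ℕ} (hz : z < m) (hz' : z' < m)
    (h : min i (level c) < min j (level c)) : entry m c i z < entry m c j z' := by
  have h1 : (2 * m * ((min i (level c) : ℕ) + 1) : ℤ) ≤ 2 * m * (min j (level c) : ℕ) :=
    mul_le_mul_of_nonneg_left (by exact_mod_cast h) (by positivity)
  unfold entry
  split_ifs <;> nlinarith

theorem entry_eq_of_min_eq {m c i j z : ℕ} (h : min i (level c) = min j (level c)) :
    entry m c i z = entry m c j z := by
  unfold entry
  rw [h]

section Key

variable {m : ℕ} {x y x' y' : Fin (2 ^ r - 1) → Fin m} {c c' : Fin (2 ^ r - 1)} {i j : Fin r}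

theorem key_lt_key_of_min_lt (hxy : ∀ b < c, x b = y b)
    (h : min (i : ℕ) (level c) < min (j : ℕ) (level c)) : key x i < key y j := by
  classical
  -- the keys first differ where the positions first fall into different blocks
  let s := univ.filter fun b : Fin (2 ^ r - 1) =>
    min (i : ℕ) (level b) < min (j : ℕ) (level b)
  have hs : c ∈ s := by simpa [s] using h
  have hmem : ∀ b, b ∈ s ↔ min (i : ℕ) (level b) < min (j : ℕ) (level b) := by simp [s]
  refine ⟨s.min' ⟨c, hs⟩, fun b hb => ?_, ?_⟩
  · have hbc : b < c := hb.trans_le (min'_le _ _ hs)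
    have hbs : b ∉ s := fun hbs => (min'_le _ _ hbs).not_gt hb
    rw [hmem] at hbs
    change entry m b i (x b) = entry m b j (y b)
    rw [hxy b hbc]
    exact entry_eq_of_min_eq (by omega)
  · exact entry_lt_of_min_lt (x _).2 (y _).2 ((hmem _).1 (min'_mem s ⟨c, hs⟩))

theorem key_compare (hxy : ∀ b < c, x b = y b) (hc : x c < y c)
    (h : min (i : ℕ) (level c) = min (j : ℕ) (level c)) :
    (Positive c (min (i : ℕ) (level c)) → key x i < key y j) ∧
      (¬ Positive c (min (i : ℕ) (level c)) → key y j < key x i) := by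
  have hlt : ∀ b < c, entry m b i (x b) = entry m b j (y b) := by
    intro b hb
    have : level b ≤ level c := level_mono (show (b : ℕ) ≤ c from hb.le)
    rw [hxy b hb]
    exact entry_eq_of_min_eq (by omega)
  have hc' : ((x c : ℕ) : ℤ) < (y c : ℕ) := by exact_mod_cast hc
  refine ⟨fun hp => ⟨c, hlt, ?_⟩, fun hp => ⟨c, fun b hb => (hlt b hb).symm, ?_⟩⟩
  · change entry m c i (x c) < entry m c j (y c)
    rw [← entry_eq_of_min_eq h]
    unfold entry
    rw [if_pos hp, if_pos hp]
    omega
  · change entry m c j (y c) < entry m c i (x c)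
    rw [← entry_eq_of_min_eq h]
    unfold entry
    rw [if_neg hp, if_neg hp]
    omega

theorem strictMono_key (x : Fin (2 ^ r - 1) → Fin m) : StrictMono (key x) := by
  intro i j hij
  have hr : 0 < r := i.pos
  have h1 : 2 ^ (r - 1) < 2 ^ r := Nat.pow_lt_pow_right (by norm_num) (by omega)
  have h2 : 0 < 2 ^ (r - 1) := by positivity
  refine key_lt_key_of_min_lt (c := ⟨2 ^ (r - 1) - 1, by omega⟩) (fun _ _ => rfl) ?_
  have hl : level (2 ^ (r - 1) - 1) = r - 1 := by
    rw [level, Nat.sub_add_cancel h2, Nat.log_pow (by norm_num)]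
  simp only [hl]
  have := j.2
  have : (i : ℕ) < j := hij
  omega

theorem exists_first_difference (h : x ≠ y) :
    ∃ c, (∀ b < c, x b = y b) ∧ (x c < y c ∨ y c < x c) := by
  rcases lt_trichotomy (toLex x) (toLex y) with ⟨c, h1, h2⟩ | h' | ⟨c, h1, h2⟩
  · exact ⟨c, h1, Or.inl h2⟩
  · exact absurd h' h
  · exact ⟨c, fun b hb => (h1 b hb).symm, Or.inr h2⟩

theorem key_ne_key (h : x ≠ y) : key x i ≠ key y j := by
  have aux : ∀ {x y : Fin (2 ^ r - 1) → Fin m} {c : Fin (2 ^ r - 1)} {i j : Fin r},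
      (∀ b < c, x b = y b) → x c < y c → key x i ≠ key y j := by
    intro x y c i j hxy hc
    rcases lt_trichotomy (min (i : ℕ) (level c)) (min (j : ℕ) (level c)) with h | h | h
    · exact (key_lt_key_of_min_lt hxy h).ne
    · by_cases hp : Positive c (min (i : ℕ) (level c))
      · exact ((key_compare hxy hc h).1 hp).ne
      · exact ((key_compare hxy hc h).2 hp).ne'
    · exact (key_lt_key_of_min_lt (fun b hb => (hxy b hb).symm) h).ne'
  obtain ⟨c, hxy, hc | hc⟩ := exists_first_difference h
  · exact aux hxy hc
  · exact (aux (fun b hb => (hxy b hb).symm) hc).symm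

/-- At the first difference `c`, positions `level c` and `level c + 1` share a block, so the
interlacing shows the number of cuts. -/
theorem level_le_of_sameOrder (hxy : ∀ b < c, x b = y b) (hc : x c < y c)
    (hxy' : ∀ b < c', x' b = y' b) (h : SameOrder (key x) (key y) (key x') (key y')) :
    level c' ≤ level c := by
  by_contra! hlt
  have hr := level_lt c'
  let i : Fin r := ⟨level c, by omega⟩
  let j : Fin r := ⟨level c + 1, by omega⟩
  have hij : min (i : ℕ) (level c') < min (j : ℕ) (level c') := by
    simp only [i, j]
    omega
  have hji : min (i : ℕ) (level c) = min (j : ℕ) (level c) := by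
    simp only [i, j]
    omega
  have h1 : key x i < key y j := (h i j).1.2 (key_lt_key_of_min_lt hxy' hij)
  have h2 : key y i < key x j :=
    (h i j).2.2 (key_lt_key_of_min_lt (fun b hb => (hxy' b hb).symm) hij)
  by_cases hp : Positive c (min (i : ℕ) (level c))
  · exact lt_asymm h2 ((key_compare hxy hc hji.symm).1 (hji ▸ hp))
  · exact lt_asymm h1 ((key_compare hxy hc hji).2 hp)

theorem key_lt_key_iff_positive (hxy : ∀ b < c, x b = y b) (hc : x c < y c)
    (hi : (i : ℕ) ≤ level c) : key x i < key y i ↔ Positive c i := by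
  have h := key_compare (i := i) hxy hc rfl
  rw [min_eq_left hi] at h
  by_cases hp : Positive c i
  · exact iff_of_true (h.1 hp) hp
  · exact iff_of_false (h.2 hp).not_gt hp

theorem first_difference_eq_of_sameOrder (hxy : ∀ b < c, x b = y b) (hc : x c < y c)
    (hxy' : ∀ b < c', x' b = y' b) (hc' : x' c' < y' c')
    (h : SameOrder (key x) (key y) (key x') (key y')) : c = c' := by
  have hl : level c = level c' := le_antisymm
    (level_le_of_sameOrder hxy' hc' hxy fun i j => ⟨(h i j).1.symm, (h i j).2.symm⟩)
    (level_le_of_sameOrder hxy hc hxy' h)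
  refine Fin.ext (eq_of_level_eq hl fun b hb => ?_)
  have hr := level_lt c
  let i : Fin r := ⟨b, by omega⟩
  exact (key_lt_key_iff_positive (i := i) hxy hc hb).symm.trans
    ((h i i).1.trans (key_lt_key_iff_positive (i := i) hxy' hc' (hl ▸ hb)))

theorem not_sameOrder_swap (hr : 0 < r) (hxy : ∀ b < c, x b = y b) (hc : x c < y c)
    (hxy' : ∀ b < c', x' b = y' b) (hc' : x' c' < y' c') :
    ¬ SameOrder (key x) (key y) (key y') (key x') := by
  intro h
  let i : Fin r := ⟨0, hr⟩
  have h1 := (key_lt_key_iff_positive (i := i) hxy hc (Nat.zero_le _)).2 (Or.inl rfl)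
  have h2 := (key_lt_key_iff_positive (i := i) hxy' hc' (Nat.zero_le _)).2 (Or.inl rfl)
  exact lt_asymm h2 ((h i i).1.1 h1)

/-- The pattern formed by two edges determines the first coordinate in which they differ. -/
theorem first_difference_eq (hr : 0 < r) (hxy : ∀ b < c, x b = y b) (hc : x c < y c ∨ y c < x c)
    (hxy' : ∀ b < c', x' b = y' b) (hc' : x' c' < y' c' ∨ y' c' < x' c')
    (h : SameOrder (key x) (key y) (key x') (key y') ∨
      SameOrder (key x) (key y) (key y') (key x')) : c = c' := by
  have hyx : ∀ b < c, y b = x b := fun b hb => (hxy b hb).symm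
  have hyx' : ∀ b < c', y' b = x' b := fun b hb => (hxy' b hb).symm
  have hswap : ∀ {u v u' v' : Fin r → Lex (Fin (2 ^ r - 1) → ℤ)}, SameOrder u v u' v' →
      SameOrder v u v' u' := fun h i j => (h i j).symm
  rcases hc with hc | hc <;> rcases hc' with hc' | hc' <;> rcases h with h | h
  · exact first_difference_eq_of_sameOrder hxy hc hxy' hc' h
  · exact absurd h (not_sameOrder_swap hr hxy hc hxy' hc')
  · exact absurd h (not_sameOrder_swap hr hxy hc hyx' hc')
  · exact first_difference_eq_of_sameOrder hxy hc hyx' hc' h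
  · exact absurd (hswap h) (not_sameOrder_swap hr hyx hc hxy' hc')
  · exact first_difference_eq_of_sameOrder hyx hc hxy' hc' (hswap h)
  · exact first_difference_eq_of_sameOrder hyx hc hyx' hc' (hswap h)
  · exact absurd (hswap h) (not_sameOrder_swap hr hyx hc hyx' hc')

end Key

theorem ramseyNumber_le_of_le_pow (hr : 0 < r) {n m : ℕ} (h : n ≤ m ^ (2 ^ r - 1)) :
    ramseyNumber r n ≤ m := by
  classical
  obtain ⟨g⟩ : Nonempty (Fin n ↪ (Fin (2 ^ r - 1) → Fin m)) :=
    Embedding.nonempty_of_card_le (by simpa using h)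
  have hinj : Injective fun a : Fin n × Fin r => key (g a.1) a.2 := by
    rintro ⟨a, i⟩ ⟨b, j⟩ hab
    by_cases h : a = b
    · subst h
      exact Prod.ext rfl ((strictMono_key (g a)).injective hab)
    · exact absurd hab (key_ne_key (g.injective.ne h))
  obtain ⟨ρ, hρ⟩ := exists_equiv_fin_lt_iff (k := r * n) (by simp [mul_comm]) hinj
  refine ((isLeast_ramseyNumber hr n).2
    ⟨ofEquiv ρ, by rw [size_ofEquiv hr, Fintype.card_fin], rfl⟩).trans
    (maxClique_ofEquiv_le hr (fun a => strictMono_key (g a)) hρ fun T hT => ?_)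
  -- some coordinate `c` separates the edges in `T`
  obtain ⟨c, hc⟩ : ∃ c, Set.InjOn (fun a => g a c) T := by
    by_cases hne : ∃ a ∈ T, ∃ b ∈ T, a ≠ b
    · obtain ⟨a, ha, b, hb, hab⟩ := hne
      obtain ⟨c, hc1, hc2⟩ := exists_first_difference (g.injective.ne hab)
      refine ⟨c, fun a' ha' b' hb' heq => ?_⟩
      by_contra hab'
      obtain ⟨c', hc1', hc2'⟩ := exists_first_difference (g.injective.ne hab')
      have hcc := first_difference_eq hr hc1 hc2 hc1' hc2'
        (hT a ha b hb a' ha' b' hb' hab hab')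
      subst hcc
      exact hc2'.elim (fun h => h.ne heq) fun h => h.ne' heq
    · have hpos : 0 < 2 ^ r - 1 := Nat.sub_pos_of_lt (Nat.one_lt_two_pow hr.ne')
      refine ⟨⟨0, hpos⟩, fun a ha b hb _ => ?_⟩
      by_contra hab
      exact hne ⟨a, ha, b, hb, hab⟩
  have := card_le_card_of_injOn (t := univ) (fun a => g a c) (fun _ _ => mem_univ _) hc
  simpa using this

open scoped Nat in
theorem le_mul_ramseyNumber_pow (hr : 0 < r) (n : ℕ) :
    n ≤ (2 * r - 1)‼ * ramseyNumber r n ^ (2 ^ r - 1) := by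
  obtain ⟨M, hM, hk⟩ := (isLeast_ramseyNumber hr n).1
  rw [← hk]
  exact hM.symm.trans_le (size_le_mul_maxClique_pow hr M)

theorem ramseyNumber_le_ceil (hr : 0 < r) {k : ℕ} (hk : k = 2 ^ r - 1) (n : ℕ) :
    ramseyNumber r n ≤ ⌈(n : ℝ) ^ (1 / k : ℝ)⌉₊ := by
  have hk0 : k ≠ 0 := by
    have := Nat.one_lt_two_pow hr.ne'
    omega
  refine ramseyNumber_le_of_le_pow hr ?_
  rw [← hk]
  have h : (n : ℝ) = ((n : ℝ) ^ (1 / k : ℝ)) ^ k := by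
    rw [one_div, Real.rpow_inv_natCast_pow n.cast_nonneg hk0]
  have h' : (n : ℝ) ≤ (⌈(n : ℝ) ^ (1 / k : ℝ)⌉₊ : ℝ) ^ k := by
    conv_lhs => rw [h]
    exact pow_le_pow_left₀ (by positivity) (Nat.le_ceil _) k
  exact_mod_cast h'

open scoped Nat in
theorem mul_rpow_le_ramseyNumber (hr : 0 < r) {k C : ℕ} (hk : k = 2 ^ r - 1) (hC0 : C ≠ 0)
    (hC : (2 * r - 1)‼ ≤ C ^ k) (n : ℕ) :
    (1 / C : ℝ) * (n : ℝ) ^ (1 / k : ℝ) ≤ ramseyNumber r n := by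
  have hk0 : k ≠ 0 := by
    have := Nat.one_lt_two_pow hr.ne'
    omega
  have h : n ≤ (C * ramseyNumber r n) ^ k := by
    rw [mul_pow]
    exact (hk ▸ le_mul_ramseyNumber_pow hr n).trans (Nat.mul_le_mul_right _ hC)
  have h' : (n : ℝ) ^ (1 / k : ℝ) ≤ C * ramseyNumber r n := by
    rw [one_div, Real.rpow_inv_le_iff_of_pos n.cast_nonneg (by positivity) (by positivity),
      Real.rpow_natCast]
    exact_mod_cast h
  rw [one_div, inv_mul_le_iff₀ (by positivity)]
  exact h'

end OrderedMatching

theorem theorem1p2 (n : ℕ) :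
    ((1 / 2 : ℝ) * (n : ℝ) ^ (1 / 7 : ℝ) ≤ (ramseyNumber 3 n : ℝ) ∧
      ramseyNumber 3 n ≤ ⌈(n : ℝ) ^ (1 / 7 : ℝ)⌉₊) ∧
    ((1 / 4 : ℝ) * (n : ℝ) ^ (1 / 15 : ℝ) ≤ (ramseyNumber 4 n : ℝ) ∧
      ramseyNumber 4 n ≤ ⌈(n : ℝ) ^ (1 / 15 : ℝ)⌉₊) := by
  refine ⟨⟨?_, ?_⟩, ?_, ?_⟩
  · exact_mod_cast OrderedMatching.mul_rpow_le_ramseyNumber (r := 3) (k := 7) (C := 2)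
      (by norm_num) (by norm_num) (by norm_num) (by decide) n
  · exact_mod_cast OrderedMatching.ramseyNumber_le_ceil (r := 3) (k := 7)
      (by norm_num) (by norm_num) n
  · exact_mod_cast OrderedMatching.mul_rpow_le_ramseyNumber (r := 4) (k := 15) (C := 4)
      (by norm_num) (by norm_num) (by norm_num) (by decide) n
  · exact_mod_cast OrderedMatching.ramseyNumber_le_ceil (r := 4) (k := 15)
      (by norm_num) (by norm_num) n
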